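/- Let $P$ be a smooth $N$-dimensional manifold, let $1\le n\le N$, and let $\hat\omega=\omega^\alpha\otimes\hat r_\alpha$ be a general $n$-symplectic (polysymplectic) structure on $P$, i.e. a smooth $\mathbb R^n$-valued 2-form ($\hat r_1,\dots,\hat r_n$ the standard basis of $\mathbb R^n$) with $d\omega^\alpha=0$ for all $\alpha$ and with $v\lrcorner\hat\omega=0\iff v=0$ for every tangent vector $v$. Round brackets around indices denote symmetrization (the average over all permutations of the enclosed indices), and $\otimes_s^k\mathbb R^n$ is the space of symmetric tensors, with $\otimes_s^0\mathbb R^n=\mathbb R$. For $p\ge 1$, call a smooth $\otimes_s^{p-1}\mathbb R^n$-valued vector field $X=(X^{\alpha_1\dots\alpha_{p-1}})$ on $P$ Hamiltonian of rank $p$ if there is a smooth function $\hat f=(\hat f^{\alpha_1\dots\alpha_p}):P\to\otimes_s^p\mathbb R^n$ with $$d\hat f^{\alpha_1\dots\alpha_p}=-p!\,X^{(\alpha_1\dots\alpha_{p-1}}\lrcorner\,\omega^{\alpha_p)} .$$ Two Hamiltonian vector fields of rank $p$ are equivalent if their difference $Y$ satisfies $Y^{(\alpha_1\dots\alpha_{p-1}}\lrcorner\,\omega^{\alpha_p)}=0$.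 Let $[\![X]\!]$ denote the equivalence class of $X$, let $SHV^p$ be the real vector space of these classes, and let $SHV=\bigoplus_{p\ge1}SHV^p$. Theorem. Let $p,q\ge 1$. If $X$ and $Z$ are Hamiltonian of rank $p$ and $q$, then the $\otimes_s^{p+q-2}\mathbb R^n$-valued vector field with components $$[X^{(\alpha_1\dots\alpha_{p-1}},\,Z^{\alpha_p\dots\alpha_{p+q-2})}]$$ (Lie brackets of vector fields, symmetrized over all upper indices) is Hamiltonian of rank $p+q-1$, and its class depends only on $[\![X]\!]$ and $[\![Z]\!]$. Hence $[\![X]\!],[\![Z]\!]\mapsto \big[\!\big[\,[X^{(\alpha_1\dots\alpha_{p-1}},Z^{\alpha_p\dots\alpha_{p+q-2})}]\,\hat r_{\alpha_1}\otimes_s\cdots\otimes_s\hat r_{\alpha_{p+q-2}}\big]\!\big]$ is a well-defined map $SHV^p\times SHV^q\to SHV^{p+q-1}$; these maps are the homogeneous parts of a unique bilinear bracket $[\![\ ,\ ]\!]$ on $SHV$, and $(SHV,[\![\ ,\ ]\!])$ is a real Lie algebra: the bracket is alternating and satisfies the Jacobi identity. -/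

import Mathlib

open scoped Manifold ContDiff DirectSum Nat
open VectorField

noncomputable section

namespace NSymplectic

/-! ### Index symmetrization -/

/-- Symmetrization over all `m` indices of a family `T^{α₁ … α_m}` with `αᵢ ∈ {1, …, n}`:
`T^{(α₁ … α_m)} = (1 / m!) ∑_σ T^{α_{σ 1} … α_{σ m}}`. -/
def symmetrize {n m : ℕ} {V : Type*} [AddCommGroup V] [Module ℝ V]
    (T : (Fin m → Fin n) → V) (J : Fin m → Fin n) : V :=
  ((m ! : ℝ)⁻¹) • ∑ σ : Equiv.Perm (Fin m), T (J ∘ σ)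

/-- A family `T^{α₁ … α_m}` that is invariant under permutations of its indices; these are
the components of an element of `⊗ₛ^m ℝⁿ ⊗ V`. -/
def IsSymmetric {n m : ℕ} {V : Type*} (T : (Fin m → Fin n) → V) : Prop :=
  ∀ (σ : Equiv.Perm (Fin m)) (J : Fin m → Fin n), T (J ∘ σ) = T J

lemma symmetrize_add {n m : ℕ} {V : Type*} [AddCommGroup V] [Module ℝ V]
    (S T : (Fin m → Fin n) → V) (J : Fin m → Fin n) :
    symmetrize (fun J => S J + T J) J = symmetrize S J + symmetrize T J := by
  simp [symmetrize, Finset.sum_add_distrib]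

lemma symmetrize_smul {n m : ℕ} {V : Type*} [AddCommGroup V] [Module ℝ V]
    (c : ℝ) (T : (Fin m → Fin n) → V) (J : Fin m → Fin n) :
    symmetrize (fun J => c • T J) J = c • symmetrize T J := by
  simp only [symmetrize, ← Finset.smul_sum]
  rw [smul_comm]

/-! ### Smooth vector fields, functions and 2-forms on an `N`-dimensional manifold -/

/-- Smooth vector fields on the `N`-dimensional manifold `P`. -/
abbrev VField (N : ℕ) (P : Type*) [TopologicalSpace P]
    [ChartedSpace (EuclideanSpace ℝ (Fin N)) P] [IsManifold (𝓡 N) ∞ P] : Type _ :=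
  ContMDiffSection (𝓡 N) (EuclideanSpace ℝ (Fin N)) ∞ (TangentSpace (𝓡 N) : P → Type _)

variable {N n : ℕ} {P : Type*} [TopologicalSpace P]
  [ChartedSpace (EuclideanSpace ℝ (Fin N)) P]

/-- The ordinary Lie bracket of two smooth vector fields. -/
def lieBr [IsManifold (𝓡 N) ∞ P] (X Y : VField N P) : VField N P where
  toFun := mlieBracket (𝓡 N) X Y
  contMDiff_toFun := by
    have : IsManifold (𝓡 N) (((⊤ : ℕ∞) : WithTop ℕ∞) + 1) P := by
      simpa using (inferInstance : IsManifold (𝓡 N) ∞ P)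
    have : IsManifold (𝓡 N) (minSmoothness ℝ 2) P :=
      IsManifold.of_le (n := ∞) (by simpa using ENat.LEInfty.out)
    have : IsManifold (𝓡 N) (minSmoothness ℝ 3) P :=
      IsManifold.of_le (n := ∞) (by simpa using ENat.LEInfty.out)
    exact ContDiff.mlieBracket_vectorField (n := ⊤) (m := ⊤) X.contMDiff Y.contMDiff (by simp)

/-- The differential `df` of a smooth function, evaluated at the tangent vector `v`. -/
def differential (f : C^∞⟮𝓡 N, P; ℝ⟯) (x : P) (v : TangentSpace (𝓡 N) x) : ℝ :=
  NormedSpace.fromTangentSpace (f x) (mfderiv (𝓡 N) 𝓘(ℝ, ℝ) f x v)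

lemma differential_add (f g : C^∞⟮𝓡 N, P; ℝ⟯) (x : P) (v : TangentSpace (𝓡 N) x) :
    differential (f + g) x v = differential f x v + differential g x v := by
  have hf : MDifferentiableAt (𝓡 N) 𝓘(ℝ, ℝ) f x :=
    f.contMDiff.mdifferentiableAt (by simp)
  have hg : MDifferentiableAt (𝓡 N) 𝓘(ℝ, ℝ) g x :=
    g.contMDiff.mdifferentiableAt (by simp)
  have h := (hf.hasMFDerivAt.add hg.hasMFDerivAt).mfderiv
  have h' := DFunLike.congr_fun h v
  exact h'

lemma differential_smul (c : ℝ) (f : C^∞⟮𝓡 N, P; ℝ⟯) (x : P) (v : TangentSpace (𝓡 N) x) :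
    differential (c • f) x v = c * differential f x v := by
  have hf : MDifferentiableAt (𝓡 N) 𝓘(ℝ, ℝ) f x :=
    f.contMDiff.mdifferentiableAt (by simp)
  have h := (hf.hasMFDerivAt.const_smul c).mfderiv
  have h' := DFunLike.congr_fun h v
  exact h'

/-- A (not necessarily continuous) differential 2-form on `P`. -/
abbrev TwoForm (N : ℕ) (P : Type*) [TopologicalSpace P]
    [ChartedSpace (EuclideanSpace ℝ (Fin N)) P] : Type _ :=
  ∀ x : P, TangentSpace (𝓡 N) x [⋀^Fin 2]→L[ℝ] ℝ

/-- The local representative of a 2-form in the chart around `x₀`: its pullback along the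
inverse of the chart. It is meaningful on the target of the chart. -/
def chartForm (Ω : TwoForm N P) (x₀ : P) (y : EuclideanSpace ℝ (Fin N)) :
    EuclideanSpace ℝ (Fin N) [⋀^Fin 2]→L[ℝ] ℝ :=
  (Ω ((extChartAt (𝓡 N) x₀).symm y)).compContinuousLinearMap
    (mfderiv 𝓘(ℝ, EuclideanSpace ℝ (Fin N)) (𝓡 N) (extChartAt (𝓡 N) x₀).symm y)

/-- A 2-form is smooth if all its local representatives are. -/
def TwoForm.IsSmooth (Ω : TwoForm N P) : Prop :=
  ∀ x₀ : P, ContDiffOn ℝ ∞ (chartForm Ω x₀) (extChartAt (𝓡 N) x₀).target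

/-- A (smooth) 2-form is closed if the exterior derivatives of all its local representatives
vanish. -/
def TwoForm.IsClosed (Ω : TwoForm N P) : Prop :=
  ∀ x₀ : P, ∀ y ∈ (extChartAt (𝓡 N) x₀).target, extDeriv (chartForm Ω x₀) y = 0

variable (N n P) in
/-- A general `n`-symplectic (polysymplectic) structure on `P`: an `ℝⁿ`-valued smooth 2-form
`ω̂ = ω^α ⊗ r̂_α`, given by its components, with `dω^α = 0` for all `α`, and with
`v ⌟ ω̂ = 0 ↔ v = 0` for all tangent vectors `v`. -/
structure Structure where
  /-- the components `ω^α` -/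
  form : Fin n → TwoForm N P
  smooth : ∀ α, (form α).IsSmooth
  closed : ∀ α, (form α).IsClosed
  nondegenerate : ∀ (x : P) (v : TangentSpace (𝓡 N) x),
    (∀ (α : Fin n) (w : TangentSpace (𝓡 N) x), form α x ![v, w] = 0) ↔ v = 0

/-! ### Generalized Hamiltonian vector fields

The rank is `p = k + 1` throughout, so that a rank `p` Hamiltonian vector field is
`⊗ₛ^k ℝⁿ`-valued; it is given by its components `X^{α₁ … α_k}`. -/

variable [IsManifold (𝓡 N) ∞ P]

/-- The components `(X^{(α₁ … α_k} ⌟ ω^{α_{k+1})})(v)` of the symmetrized interior product. -/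
def symContract (Ω : Structure N n P) {k : ℕ} (X : (Fin k → Fin n) → VField N P)
    (J : Fin (k + 1) → Fin n) (x : P) (v : TangentSpace (𝓡 N) x) : ℝ :=
  symmetrize
    (fun K : Fin (k + 1) → Fin n => Ω.form (K (Fin.last k)) x ![X (Fin.init K) x, v]) J

/-- The structure equation
`d f^{α₁ … α_p} = - p! X^{(α₁ … α_{p-1}} ⌟ ω^{α_p)}`, with `p = k + 1`. -/
def StructureEq (Ω : Structure N n P) {k : ℕ} (f : (Fin (k + 1) → Fin n) → C^∞⟮𝓡 N, P; ℝ⟯)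
    (X : (Fin k → Fin n) → VField N P) : Prop :=
  ∀ (J : Fin (k + 1) → Fin n) (x : P) (v : TangentSpace (𝓡 N) x),
    differential (f J) x v = -((k + 1)! : ℝ) * symContract Ω X J x v

lemma symContract_add (Ω : Structure N n P) {k : ℕ} (X Y : (Fin k → Fin n) → VField N P)
    (J : Fin (k + 1) → Fin n) (x : P) (v : TangentSpace (𝓡 N) x) :
    symContract Ω (X + Y) J x v = symContract Ω X J x v + symContract Ω Y J x v := by
  unfold symContract
  rw [← symmetrize_add]
  congr 1
  funext K
  exact (Ω.form (K (Fin.last k)) x).toAlternatingMap.map_vecCons_add ![v] _ _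

lemma symContract_smul (Ω : Structure N n P) {k : ℕ} (c : ℝ)
    (X : (Fin k → Fin n) → VField N P)
    (J : Fin (k + 1) → Fin n) (x : P) (v : TangentSpace (𝓡 N) x) :
    symContract Ω (c • X) J x v = c * symContract Ω X J x v := by
  unfold symContract
  rw [← smul_eq_mul, ← symmetrize_smul]
  congr 1
  funext K
  exact (Ω.form (K (Fin.last k)) x).toAlternatingMap.map_vecCons_smul ![v] _ _

lemma symContract_zero (Ω : Structure N n P) {k : ℕ}
    (J : Fin (k + 1) → Fin n) (x : P) (v : TangentSpace (𝓡 N) x) :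
    symContract Ω (0 : (Fin k → Fin n) → VField N P) J x v = 0 := by
  simpa using symContract_smul Ω (0 : ℝ) (0 : (Fin k → Fin n) → VField N P) J x v

/-- The space of all `⊗ₛ^k ℝⁿ`-valued vector fields that satisfy the structure equation for some
smooth `⊗ₛ^{k+1} ℝⁿ`-valued function `f`. -/
def HVF (Ω : Structure N n P) (k : ℕ) : Submodule ℝ ((Fin k → Fin n) → VField N P) where
  carrier := {X | IsSymmetric X ∧
    ∃ f : (Fin (k + 1) → Fin n) → C^∞⟮𝓡 N, P; ℝ⟯, IsSymmetric f ∧ StructureEq Ω f X}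
  add_mem' := by
    rintro X Y ⟨hX, f, hf, hfX⟩ ⟨hY, g, hg, hgY⟩
    refine ⟨fun σ J => ?_, f + g, fun σ J => ?_, fun J x v => ?_⟩
    · simp [hX σ J, hY σ J]
    · simp [hf σ J, hg σ J]
    · rw [Pi.add_apply, differential_add, symContract_add, hfX J x v, hgY J x v, mul_add]
  zero_mem' := by
    refine ⟨fun σ J => rfl, 0, fun σ J => rfl, fun J x v => ?_⟩
    rw [symContract_zero, mul_zero]
    simpa using differential_smul (0 : ℝ) (0 : C^∞⟮𝓡 N, P; ℝ⟯) x v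
  smul_mem' := by
    rintro c X ⟨hX, f, hf, hfX⟩
    refine ⟨fun σ J => ?_, c • f, fun σ J => ?_, fun J x v => ?_⟩
    · simp [hX σ J]
    · simp [hf σ J]
    · rw [Pi.smul_apply, differential_smul, symContract_smul, hfX J x v]
      ring

/-- The solutions `Y` of the kernel equation `Y^{(α₁ … α_k} ⌟ ω^{α_{k+1})} = 0`. -/
def kernelEq (Ω : Structure N n P) (k : ℕ) :
    Submodule ℝ ((Fin k → Fin n) → VField N P) where
  carrier := {Y | ∀ (J : Fin (k + 1) → Fin n) (x : P) (v : TangentSpace (𝓡 N) x),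
    symContract Ω Y J x v = 0}
  add_mem' := by
    intro X Y hX hY J x v
    rw [symContract_add, hX J x v, hY J x v, add_zero]
  zero_mem' := fun J x v => symContract_zero Ω J x v
  smul_mem' := by
    intro c X hX J x v
    rw [symContract_smul, hX J x v, mul_zero]

/-- The space `SHV^{k+1}` of generalized rank `k + 1` Hamiltonian vector fields: equivalence
classes of Hamiltonian `⊗ₛ^k ℝⁿ`-valued vector fields modulo solutions of the kernel equation. -/
abbrev SHVrank (Ω : Structure N n P) (k : ℕ) : Type _ :=
  HVF Ω k ⧸ (kernelEq Ω k).submoduleOf (HVF Ω k)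

/-- The equivalence class of a Hamiltonian `⊗ₛ^k ℝⁿ`-valued vector field. -/
abbrev cls (Ω : Structure N n P) {k : ℕ} (X : HVF Ω k) : SHVrank Ω k :=
  Submodule.Quotient.mk X

/-- `SHV = ⨁_{p ≥ 1} SHV^p`, indexed by `k = p - 1`. -/
abbrev SHV (Ω : Structure N n P) : Type _ :=
  ⨁ k : ℕ, SHVrank Ω k

/-- The symmetrized Lie bracket of vector-valued vector fields, with components
`[X^{(α₁ … α_k}, Y^{α_{k+1} … α_{k+l})}]`. -/
def symBracket {k l : ℕ} (X : (Fin k → Fin n) → VField N P)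
    (Y : (Fin l → Fin n) → VField N P) : (Fin (k + l) → Fin n) → VField N P :=
  symmetrize fun K : Fin (k + l) → Fin n =>
    lieBr (X (K ∘ Fin.castAdd l)) (Y (K ∘ Fin.natAdd k))

/-- A bilinear map is a Lie bracket: it is alternating and satisfies the Jacobi identity. -/
structure IsLieBracket {L : Type*} [AddCommMonoid L] [Module ℝ L]
    (B : L →ₗ[ℝ] L →ₗ[ℝ] L) : Prop where
  alternating : ∀ x, B x x = 0
  jacobi : ∀ x y z, B x (B y z) + B y (B z x) + B z (B x y) = 0

end NSymplectic

end

/-!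
By polarization, a symmetric family `T^{α₁ … α_m}` is the same thing as the homogeneous polynomial
`T(t) = T^{α₁ … α_m} t_{α₁} ⋯ t_{α_m}` in `t ∈ ℝⁿ`, and symmetrizing a family does not change its
polynomial. In terms of polynomials, up to a constant factor, `X` is Hamiltonian with function `f`
if and only if `X(t)` is for every `t` a Hamiltonian vector field, with function `f(t)`, of the
single closed 2-form `t_α ω^α`, and the symmetrized bracket of `X` and `Z` is the Lie bracket
`[X(t), Z(t)]`. For one closed 2-form, Cartan's formula shows that the Lie bracket of Hamiltonian
vector fields with functions `f` and `g` is Hamiltonian with function `X(g)`, which is zero if `g`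
is. Hence the bracket is closed and passes to equivalence classes; skew-symmetry and the Jacobi
identity are those of the Lie bracket of vector fields, for each `t`.
-/

noncomputable section

namespace NSymplectic

section PolyEval

variable {R ι V W U : Type*} {k l m : ℕ} [CommSemiring R] [Fintype ι]
  [AddCommMonoid V] [Module R V] [AddCommMonoid W] [Module R W] [AddCommMonoid U] [Module R U]

/-- The value `T(t) = ∑ t_{α₁} ⋯ t_{α_m} T^{α₁ … α_m}` at `t` of the homogeneous polynomial with
the coefficients `T^{α₁ … α_m}`, as a linear map of the family `T`. It turns identities between
symmetric tensors into identities between vectors. -/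
def polyEval (t : ι → R) : ((Fin m → ι) → V) →ₗ[R] V :=
  ∑ J : Fin m → ι, (∏ i, t (J i)) • LinearMap.proj J

lemma polyEval_apply (t : ι → R) (T : (Fin m → ι) → V) :
    polyEval t T = ∑ J : Fin m → ι, (∏ i, t (J i)) • T J := by
  simp [polyEval]

lemma map_polyEval (L : V →ₗ[R] W) (t : ι → R) (T : (Fin m → ι) → V) :
    L (polyEval t T) = polyEval t fun J => L (T J) := by
  simp [polyEval_apply]

lemma polyEval_comp_perm (t : ι → R) (T : (Fin m → ι) → V) (σ : Equiv.Perm (Fin m)) :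
    polyEval t (fun J => T (J ∘ σ)) = polyEval t T := by
  simp only [polyEval_apply]
  refine Fintype.sum_equiv (σ.symm.arrowCongr (Equiv.refl ι)) _ _ fun J => ?_
  exact congrArg (· • T (J ∘ σ)) (Equiv.prod_comp σ fun i => t (J i)).symm

lemma polyEval_append (b : V →ₗ[R] W →ₗ[R] U) (t : ι → R) (S : (Fin k → ι) → V)
    (T : (Fin l → ι) → W) :
    polyEval t (fun K : Fin (k + l) → ι => b (S (K ∘ Fin.castAdd l)) (T (K ∘ Fin.natAdd k))) =
      b (polyEval t S) (polyEval t T) := by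
  calc
    _ = ∑ p : (Fin k → ι) × (Fin l → ι),
        ((∏ i, t (p.1 i)) * ∏ i, t (p.2 i)) • b (S p.1) (T p.2) := by
      rw [polyEval_apply]
      refine (Fintype.sum_equiv (Fin.appendEquiv k l) _ _ fun p => ?_).symm
      have hl : Fin.append p.1 p.2 ∘ Fin.castAdd l = p.1 := funext (Fin.append_left _ _)
      have hr : Fin.append p.1 p.2 ∘ Fin.natAdd k = p.2 := funext (Fin.append_right _ _)
      simp [Fin.appendEquiv, hl, hr, Fin.prod_univ_add]
    _ = b (polyEval t S) (polyEval t T) := by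
      simp only [polyEval_apply, map_sum, map_smul, LinearMap.sum_apply, LinearMap.smul_apply,
        Finset.smul_sum, smul_smul, Fintype.sum_prod_type_right, mul_comm]

end PolyEval

section Symmetric

variable {m n : ℕ}

lemma isSymmetric_symmetrize {V : Type*} [AddCommGroup V] [Module ℝ V]
    (T : (Fin m → Fin n) → V) : IsSymmetric (symmetrize T) :=
  fun σ _ => congrArg ((m ! : ℝ)⁻¹ • ·) <|
    Fintype.sum_equiv (Equiv.mulLeft σ) _ _ fun _ => rfl

lemma polyEval_symmetrize {V : Type*} [AddCommGroup V] [Module ℝ V] (t : Fin n → ℝ)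
    (T : (Fin m → Fin n) → V) : polyEval t (symmetrize T) = polyEval t T := by
  have symmetrize_eq :
      symmetrize T = (m ! : ℝ)⁻¹ • ∑ σ : Equiv.Perm (Fin m), fun J => T (J ∘ σ) := by
    ext J
    simp [symmetrize]
  simp only [symmetrize_eq, map_smul, map_sum, polyEval_comp_perm, Finset.sum_const,
    Finset.card_univ, Fintype.card_perm, Fintype.card_fin]
  rw [← Nat.cast_smul_eq_nsmul ℝ, inv_smul_smul₀ (by positivity)]

lemma IsSymmetric.comp {V W : Type*} {T : (Fin m → Fin n) → V} (hT : IsSymmetric T)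
    (F : V → W) : IsSymmetric fun J => F (T J) :=
  fun σ J => congrArg F (hT σ J)

lemma IsSymmetric.sub {V : Type*} [Sub V] {S T : (Fin m → Fin n) → V} (hS : IsSymmetric S)
    (hT : IsSymmetric T) : IsSymmetric (S - T) :=
  fun σ J => congrArg₂ (· - ·) (hS σ J) (hT σ J)

lemma IsSymmetric.smul {M V : Type*} [SMul M V] {T : (Fin m → Fin n) → V}
    (hT : IsSymmetric T) (c : M) : IsSymmetric (c • T) :=
  hT.comp (c • ·)

end Symmetric

section Polarization

variable {m n : ℕ}

/-- The exponent of the monomial `t_{α₁} ⋯ t_{α_m}`. -/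
def multidegree {ι : Type*} (J : Fin m → ι) : ι →₀ ℕ :=
  ∑ i, Finsupp.single (J i) 1

lemma exists_perm_of_multidegree_eq {ι : Type*} {I J : Fin m → ι}
    (h : multidegree I = multidegree J) : ∃ σ : Equiv.Perm (Fin m), J ∘ σ = I := by
  classical
  have equiv_fiber (c : ι) : Nonempty ({a // I a = c} ≃ {a // J a = c}) := by
    refine ⟨Fintype.equivOfCardEq ?_⟩
    simpa [multidegree, Finsupp.finsetSum_apply, Finsupp.single_apply, Fintype.card_subtype]
      using DFunLike.congr_fun h c
  exact ⟨Equiv.ofFiberEquiv fun c => (equiv_fiber c).some,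
    funext fun a => Equiv.ofFiberEquiv_map _ a⟩

/-- The homogeneous polynomial `∑ T^{α₁ … α_m} t_{α₁} ⋯ t_{α_m}` in the indeterminates
`t_1, …, t_n`; `polyEval` gives its values. -/
def homogeneousPoly {R : Type*} [CommSemiring R] (T : (Fin m → Fin n) → R) :
    MvPolynomial (Fin n) R :=
  ∑ J, MvPolynomial.monomial (multidegree J) (T J)

lemma eval_homogeneousPoly {R : Type*} [CommSemiring R] (t : Fin n → R)
    (T : (Fin m → Fin n) → R) :
    MvPolynomial.eval t (homogeneousPoly T) = polyEval t T := by
  simp [homogeneousPoly, multidegree, polyEval_apply, MvPolynomial.monomial_sum_index,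
    MvPolynomial.eval_monomial, mul_comm]

lemma IsSymmetric.coeff_homogeneousPoly {R : Type*} [CommSemiring R]
    {T : (Fin m → Fin n) → R} (hT : IsSymmetric T) (J : Fin m → Fin n) :
    (homogeneousPoly T).coeff (multidegree J) =
      Finset.card {I : Fin m → Fin n | multidegree I = multidegree J} • T J := by
  have apply_eq (I : Fin m → Fin n) (h : multidegree I = multidegree J) : T I = T J := by
    obtain ⟨σ, rfl⟩ := exists_perm_of_multidegree_eq h
    exact hT σ J
  simp only [homogeneousPoly, MvPolynomial.coeff_sum, MvPolynomial.coeff_monomial]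
  rw [← Finset.sum_filter, ← Finset.sum_const]
  exact Finset.sum_congr rfl fun I hI => apply_eq I (Finset.mem_filter.1 hI).2

lemma IsSymmetric.eq_zero_of_polyEval {R : Type*} [CommRing R] [IsDomain R] [CharZero R]
    {T : (Fin m → Fin n) → R} (hT : IsSymmetric T) (h : ∀ t : Fin n → R, polyEval t T = 0) :
    T = 0 := by
  have poly_eq_zero : homogeneousPoly T = 0 := MvPolynomial.funext fun t => by
    rw [eval_homogeneousPoly, h, map_zero]
  funext J
  have hJ := hT.coeff_homogeneousPoly J
  rw [poly_eq_zero, MvPolynomial.coeff_zero, eq_comm, smul_eq_zero] at hJ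
  exact hJ.resolve_left (Finset.card_ne_zero_of_mem (Finset.mem_filter_univ J |>.2 rfl))

lemma IsSymmetric.ext_polyEval {K V : Type*} [Field K] [CharZero K] [AddCommGroup V]
    [Module K V] {S T : (Fin m → Fin n) → V} (hS : IsSymmetric S) (hT : IsSymmetric T)
    (h : ∀ t : Fin n → K, polyEval t S = polyEval t T) : S = T := by
  rw [← sub_eq_zero]
  funext J
  refine (Module.forall_dual_apply_eq_zero_iff K _).1 fun L => ?_
  refine congrFun (((hS.sub hT).comp L).eq_zero_of_polyEval fun t => ?_) J
  rw [← map_polyEval, map_sub, h t, sub_self, map_zero]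

end Polarization

section Flat

variable {𝕜 E F : Type*} [NontriviallyNormedField 𝕜] [NormedAddCommGroup E] [NormedSpace 𝕜 E]
  [NormedAddCommGroup F] [NormedSpace 𝕜 F]

lemma alternating_two_swap (η : E [⋀^Fin 2]→L[𝕜] F) (v w : E) : η ![v, w] = -η ![w, v] := by
  simpa [Matrix.vecHead] using! η.map_swap ![w, v] zero_ne_one

lemma fderiv_lieBracket_apply {f : E → F} {V W : E → E} {y : E}
    (hf : ContDiffAt 𝕜 (minSmoothness 𝕜 2) f y) (hV : DifferentiableAt 𝕜 V y)
    (hW : DifferentiableAt 𝕜 W y) :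
    fderiv 𝕜 f y (lieBracket 𝕜 V W y) =
      fderiv 𝕜 (fun y' => fderiv 𝕜 f y' (W y')) y (V y) -
        fderiv 𝕜 (fun y' => fderiv 𝕜 f y' (V y')) y (W y) := by
  have hf' : DifferentiableAt 𝕜 (fderiv 𝕜 f) y :=
    ((hf.of_le le_minSmoothness).fderiv_right (m := 1) (by norm_num)).differentiableAt (by simp)
  have second_symm := hf.isSymmSndFDerivAt le_rfl (V y) (W y)
  rw [fderiv_clm_apply hf' hW, fderiv_clm_apply hf' hV]
  simp [lieBracket, second_symm]

lemma extDeriv_apply_three {η : E → E [⋀^Fin 2]→L[𝕜] F} {X Y Z : E → E} {y : E}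
    (hη : DifferentiableAt 𝕜 η y) (hX : DifferentiableAt 𝕜 X y) (hY : DifferentiableAt 𝕜 Y y)
    (hZ : DifferentiableAt 𝕜 Z y) :
    extDeriv η y ![X y, Y y, Z y] =
      fderiv 𝕜 (fun y' => η y' ![Y y', Z y']) y (X y) -
        fderiv 𝕜 (fun y' => η y' ![X y', Z y']) y (Y y) +
        fderiv 𝕜 (fun y' => η y' ![X y', Y y']) y (Z y) -
        η y ![lieBracket 𝕜 X Y y, Z y] + η y ![lieBracket 𝕜 X Z y, Y y] -
        η y ![lieBracket 𝕜 Y Z y, X y] := by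
  have cartan := extDeriv_apply_vectorField (V := ![X, Y, Z]) hη (by simp [Fin.forall_fin_succ, *])
  have vec_three (y' : E) : (fun i => ![X, Y, Z] i y') = ![X y', Y y', Z y'] :=
    List.ofFn_inj.1 rfl
  have removeNth_one (u v w : E) : Fin.removeNth 1 ![u, v, w] = ![u, w] := List.ofFn_inj.1 rfl
  have removeNth_two (u v w : E) : Fin.removeNth 2 ![u, v, w] = ![u, v] := List.ofFn_inj.1 rfl
  have removeNth_one' (u v : E) : Fin.removeNth 1 ![u, v] = ![u] := List.ofFn_inj.1 rfl
  have Ici_zero : Finset.Ici (0 : Fin 2) = {0, 1} := rfl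
  have Ici_one : Finset.Ici (1 : Fin 2) = {1} := rfl
  simp only [vec_three] at cartan
  rw [cartan, Fin.sum_univ_three, Fin.sum_univ_two, Ici_zero, Ici_one,
    Finset.sum_pair (zero_ne_one' (Fin 2)), Finset.sum_singleton]
  simp only [Int.reduceNeg, Nat.succ_eq_add_one, Fin.isValue, Fin.coe_ofNat_eq_mod, zero_add,
    Nat.zero_mod, pow_zero, Fin.removeNth_zero, Fin.tail_vecCons, Matrix.cons_val',
    Matrix.cons_val_fin_one, Matrix.cons_val_zero, one_smul, Nat.one_mod, pow_one, removeNth_one,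
    Matrix.cons_val_one, neg_smul, Nat.mod_succ, even_two, Even.neg_pow, one_pow, removeNth_two,
    Matrix.cons_val, add_zero, Fin.castSucc_zero, Fin.succ_zero_eq_one, Fin.succ_one_eq_two,
    removeNth_one', Even.add_self, Fin.castSucc_one]
  abel

lemma fderiv_apply_eq_apply_lieBracket {η : E → E [⋀^Fin 2]→L[𝕜] F} {X Z : E → E} {f g : E → F}
    {y : E} (hη : DifferentiableAt 𝕜 η y) (hclosed : extDeriv η y = 0)
    (hX : DifferentiableAt 𝕜 X y) (hZ : DifferentiableAt 𝕜 Z y)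
    (hf : ContDiffAt 𝕜 (minSmoothness 𝕜 2) f y) (hg : ContDiffAt 𝕜 (minSmoothness 𝕜 2) g y)
    (hfX : ∀ᶠ y' in nhds y, ∀ v, fderiv 𝕜 f y' v = η y' ![X y', v])
    (hgZ : ∀ᶠ y' in nhds y, ∀ v, fderiv 𝕜 g y' v = η y' ![Z y', v]) (v : E) :
    fderiv 𝕜 (fun y' => fderiv 𝕜 g y' (X y')) y v = η y ![lieBracket 𝕜 X Z y, v] := by
  have hv : DifferentiableAt 𝕜 (fun _ : E => v) y := differentiableAt_const v
  have contract_X (W : E → E) : (fun y' => η y' ![X y', W y']) =ᶠ[nhds y]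
      fun y' => fderiv 𝕜 f y' (W y') := hfX.mono fun y' h => (h (W y')).symm
  have contract_Z (W : E → E) : (fun y' => η y' ![Z y', W y']) =ᶠ[nhds y]
      fun y' => fderiv 𝕜 g y' (W y') := hgZ.mono fun y' h => (h (W y')).symm
  have cartan := extDeriv_apply_three hη hX hZ hv
  rw [hclosed, (contract_Z _).fderiv_eq, (contract_X _).fderiv_eq, (contract_X _).fderiv_eq,
    alternating_two_swap _ _ (Z y), alternating_two_swap _ _ (X y), ← hfX.self_of_nhds,
    ← hgZ.self_of_nhds, fderiv_lieBracket_apply hg hX hv, fderiv_lieBracket_apply hf hZ hv]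
    at cartan
  refine sub_eq_zero.1 (Eq.trans ?_ cartan.symm)
  abel

end Flat

section Manifold

variable {N : ℕ} {P : Type*} [TopologicalSpace P] [ChartedSpace (EuclideanSpace ℝ (Fin N)) P]

lemma chartForm_apply (Ω : TwoForm N P) (x₀ : P) (y v w : EuclideanSpace ℝ (Fin N)) :
    chartForm Ω x₀ y ![v, w] = Ω ((extChartAt (𝓡 N) x₀).symm y)
      ![mfderiv (𝓡 N) (𝓡 N) (extChartAt (𝓡 N) x₀).symm y v,
        mfderiv (𝓡 N) (𝓡 N) (extChartAt (𝓡 N) x₀).symm y w] :=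
  congrArg (Ω ((extChartAt (𝓡 N) x₀).symm y)) (funext (Fin.forall_fin_two.2 ⟨rfl, rfl⟩))

/-- The differential at a tangent vector as a linear form on smooth functions. -/
def differentialₗ (x : P) (v : TangentSpace (𝓡 N) x) : C^∞⟮𝓡 N, P; ℝ⟯ →ₗ[ℝ] ℝ where
  toFun f := differential f x v
  map_add' f g := differential_add f g x v
  map_smul' c f := differential_smul c f x v

variable [IsManifold (𝓡 N) ∞ P]

lemma mdifferentiableAt_vField (X : VField N P) (x : P) :
    MDifferentiableAt (𝓡 N) (𝓡 N).tangent
      (fun x => (⟨x, X x⟩ : TangentBundle (𝓡 N) P)) x :=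
  X.contMDiff.mdifferentiableAt (by simp)

/-- The derivative `X(f) = df(X)` of a smooth function along a smooth vector field. -/
def dirDeriv (X : VField N P) (f : C^∞⟮𝓡 N, P; ℝ⟯) : C^∞⟮𝓡 N, P; ℝ⟯ where
  val x := differential f x (X x)
  property := (contMDiff_snd_tangentBundle_modelSpace ℝ 𝓘(ℝ, ℝ)).comp <|
    (f.contMDiff.contMDiff_tangentMap (by simp)).comp X.contMDiff

/-- `dirDeriv` as a bilinear map. -/
def dirDerivₗ : VField N P →ₗ[ℝ] C^∞⟮𝓡 N, P; ℝ⟯ →ₗ[ℝ] C^∞⟮𝓡 N, P; ℝ⟯ :=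
  LinearMap.mk₂ ℝ dirDeriv
    (fun X Y f => by ext x; exact map_add (mfderiv (𝓡 N) 𝓘(ℝ, ℝ) f x) (X x) (Y x))
    (fun c X f => by ext x; exact map_smul (mfderiv (𝓡 N) 𝓘(ℝ, ℝ) f x) c (X x))
    (fun X f g => by ext x; exact differential_add f g x (X x))
    (fun c X f => by ext x; exact differential_smul c f x (X x))

lemma lieBr_swap (X Y : VField N P) : lieBr X Y = -lieBr Y X := by
  ext1 x
  exact mlieBracket_swap_apply

lemma lieBr_add_left (X Y Z : VField N P) : lieBr (X + Y) Z = lieBr X Z + lieBr Y Z := by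
  ext1 x
  exact mlieBracket_add_left (mdifferentiableAt_vField X x) (mdifferentiableAt_vField Y x)

lemma lieBr_smul_left (c : ℝ) (X Y : VField N P) : lieBr (c • X) Y = c • lieBr X Y := by
  ext1 x
  exact mlieBracket_const_smul_left (mdifferentiableAt_vField X x)

/-- `lieBr` as a bilinear map. -/
def lieBrₗ : VField N P →ₗ[ℝ] VField N P →ₗ[ℝ] VField N P :=
  LinearMap.mk₂ ℝ lieBr lieBr_add_left lieBr_smul_left
    (fun X Y Z => by rw [lieBr_swap, lieBr_add_left, neg_add, ← lieBr_swap, ← lieBr_swap])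
    (fun c X Y => by rw [lieBr_swap, lieBr_smul_left, ← smul_neg, ← lieBr_swap])

lemma lieBr_jacobi (X Y Z : VField N P) :
    lieBr X (lieBr Y Z) + lieBr Y (lieBr Z X) + lieBr Z (lieBr X Y) = 0 := by
  have : IsManifold (𝓡 N) (minSmoothness ℝ 3) P :=
    IsManifold.of_le (n := ∞) (by simpa using ENat.LEInfty.out)
  have contMDiff_two (W : VField N P) : ContMDiff (𝓡 N) (𝓡 N).tangent (minSmoothness ℝ 2)
      (fun x => (⟨x, W x⟩ : TangentBundle (𝓡 N) P)) :=
    W.contMDiff.of_le (by simpa using ENat.LEInfty.out)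
  have leibniz : lieBr X (lieBr Y Z) = lieBr (lieBr X Y) Z + lieBr Y (lieBr X Z) := by
    ext1 x
    exact leibniz_identity_mlieBracket_apply (contMDiff_two X x) (contMDiff_two Y x)
      (contMDiff_two Z x)
  have swap_inner : lieBr Y (lieBr Z X) = -lieBr Y (lieBr X Z) := by
    rw [lieBr_swap Z X]
    exact map_neg (lieBrₗ Y) _
  rw [leibniz, swap_inner, lieBr_swap Z]
  abel

/-- The local representative of a vector field in the chart around `x₀`. It is meaningful on the
target of the chart. -/
def chartField (X : VField N P) (x₀ : P) (y : EuclideanSpace ℝ (Fin N)) :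
    EuclideanSpace ℝ (Fin N) :=
  mpullback (𝓡 N) (𝓡 N) (extChartAt (𝓡 N) x₀).symm X y

section Chart

variable {x₀ : P} {y : EuclideanSpace ℝ (Fin N)}

lemma contMDiffAt_extChartAt_symm (hy : y ∈ (extChartAt (𝓡 N) x₀).target) :
    ContMDiffAt (𝓡 N) (𝓡 N) ∞ (extChartAt (𝓡 N) x₀).symm y :=
  (contMDiffOn_extChartAt_symm x₀).contMDiffAt (extChartAt_target_mem_nhds' hy)

lemma isInvertible_mfderiv_extChartAt_symm (hy : y ∈ (extChartAt (𝓡 N) x₀).target) :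
    (mfderiv (𝓡 N) (𝓡 N) (extChartAt (𝓡 N) x₀).symm y).IsInvertible := by
  have := isInvertible_mfderivWithin_extChartAt_symm (I := 𝓡 N) hy
  rwa [ModelWithCorners.range_eq_univ, mfderivWithin_univ] at this

lemma mfderiv_chartField (X : VField N P) (hy : y ∈ (extChartAt (𝓡 N) x₀).target) :
    mfderiv (𝓡 N) (𝓡 N) (extChartAt (𝓡 N) x₀).symm y
      (chartField X x₀ y) = X ((extChartAt (𝓡 N) x₀).symm y) :=
  (isInvertible_mfderiv_extChartAt_symm hy).self_apply_inverse _

lemma contDiffAt_chartField (X : VField N P) (hy : y ∈ (extChartAt (𝓡 N) x₀).target) :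
    ContDiffAt ℝ ∞ (chartField X x₀) y :=
  contMDiffAt_vectorSpace_iff_contDiffAt.1 <|
    X.contMDiff.contMDiffAt.mpullback_vectorField_preimage (contMDiffAt_extChartAt_symm hy)
      (isInvertible_mfderiv_extChartAt_symm hy) (by simp)

lemma chartField_lieBr (X Y : VField N P) (hy : y ∈ (extChartAt (𝓡 N) x₀).target) :
    chartField (lieBr X Y) x₀ y = lieBracket ℝ (chartField X x₀) (chartField Y x₀) y := by
  have : IsManifold (𝓡 N) (minSmoothness ℝ 3) P :=
    IsManifold.of_le (n := ∞) (by simpa using ENat.LEInfty.out)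
  have pullback := mpullback_mlieBracket (mdifferentiableAt_vField X _)
    (mdifferentiableAt_vField Y _) (contMDiffAt_extChartAt_symm hy)
    (by simpa using ENat.LEInfty.out)
  have flat := (mlieBracketWithin_eq_lieBracketWithin (𝕜 := ℝ) (V := chartField X x₀)
    (W := chartField Y x₀) (s := Set.univ)).trans lieBracketWithin_univ
  exact pullback.trans (congrFun flat y)

lemma contDiffAt_comp_extChartAt_symm (f : C^∞⟮𝓡 N, P; ℝ⟯)
    (hy : y ∈ (extChartAt (𝓡 N) x₀).target) :
    ContDiffAt ℝ ∞ (f ∘ (extChartAt (𝓡 N) x₀).symm) y :=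
  (f.contMDiff.contMDiffAt.comp y (contMDiffAt_extChartAt_symm hy)).contDiffAt

lemma fderiv_comp_extChartAt_symm (f : C^∞⟮𝓡 N, P; ℝ⟯)
    (hy : y ∈ (extChartAt (𝓡 N) x₀).target) (v : EuclideanSpace ℝ (Fin N)) :
    fderiv ℝ (f ∘ (extChartAt (𝓡 N) x₀).symm) y v =
      differential f ((extChartAt (𝓡 N) x₀).symm y)
        (mfderiv (𝓡 N) (𝓡 N) (extChartAt (𝓡 N) x₀).symm y v) := by
  rw [← mfderiv_eq_fderiv, mfderiv_comp y (f.contMDiff.mdifferentiableAt (by simp))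
    ((contMDiffAt_extChartAt_symm hy).mdifferentiableAt (by simp))]
  rfl

lemma dirDeriv_comp_extChartAt_symm (X : VField N P) (f : C^∞⟮𝓡 N, P; ℝ⟯)
    (hy : y ∈ (extChartAt (𝓡 N) x₀).target) :
    (dirDeriv X f ∘ (extChartAt (𝓡 N) x₀).symm) y =
      fderiv ℝ (f ∘ (extChartAt (𝓡 N) x₀).symm) y (chartField X x₀ y) := by
  rw [fderiv_comp_extChartAt_symm f hy, mfderiv_chartField X hy]
  rfl

end Chart

/-- The contraction `(X ⌟ Ω)(v)`, as a bilinear map in `X` and `Ω`. -/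
def contractₗ (x : P) (v : TangentSpace (𝓡 N) x) : VField N P →ₗ[ℝ] TwoForm N P →ₗ[ℝ] ℝ :=
  LinearMap.mk₂ ℝ (fun X Ω => Ω x ![X x, v])
    (fun X Y Ω => (Ω x).toAlternatingMap.map_vecCons_add ![v] (X x) (Y x))
    (fun c X Ω => (Ω x).toAlternatingMap.map_vecCons_smul ![v] c (X x))
    (fun _ _ _ => rfl) (fun _ _ _ => rfl)

/-- `X` is a Hamiltonian vector field of the 2-form `Ω` with Hamiltonian function `f`, with the
sign convention `df = X ⌟ Ω`. -/
def IsHamiltonian (Ω : TwoForm N P) (f : C^∞⟮𝓡 N, P; ℝ⟯) (X : VField N P) : Prop :=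
  ∀ x v, differential f x v = Ω x ![X x, v]

lemma isHamiltonian_iff_chart {Ω : TwoForm N P} {f : C^∞⟮𝓡 N, P; ℝ⟯} {X : VField N P} :
    IsHamiltonian Ω f X ↔ ∀ x₀, ∀ y ∈ (extChartAt (𝓡 N) x₀).target, ∀ v,
      fderiv ℝ (f ∘ (extChartAt (𝓡 N) x₀).symm) y v =
        chartForm Ω x₀ y ![chartField X x₀ y, v] := by
  constructor
  · intro h x₀ y hy v
    rw [fderiv_comp_extChartAt_symm f hy, h, chartForm_apply, mfderiv_chartField X hy]
  · intro h x
    rw [← extChartAt_to_inv (I := 𝓡 N) x]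
    have hy := mem_extChartAt_target (I := 𝓡 N) x
    intro v
    obtain ⟨w : EuclideanSpace ℝ (Fin N), rfl⟩ :=
      (isInvertible_mfderiv_extChartAt_symm hy).surjective v
    refine (fderiv_comp_extChartAt_symm f hy w).symm.trans ?_
    rw [h x _ hy, chartForm_apply, mfderiv_chartField X hy]

lemma IsHamiltonian.neg {Ω : TwoForm N P} {f : C^∞⟮𝓡 N, P; ℝ⟯} {X : VField N P}
    (h : IsHamiltonian Ω f X) : IsHamiltonian Ω (-f) (-X) := by
  intro x v
  calc
    differential (-f) x v = -differential f x v := map_neg (differentialₗ x v) f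
    _ = -Ω x ![X x, v] := by rw [h]
    _ = Ω x ![(-X) x, v] := (LinearMap.map_neg₂ (contractₗ x v) X Ω).symm

lemma IsHamiltonian.dirDeriv_lieBr {Ω : TwoForm N P} (hsmooth : Ω.IsSmooth)
    (hclosed : Ω.IsClosed) {f g : C^∞⟮𝓡 N, P; ℝ⟯} {X Y : VField N P} (hX : IsHamiltonian Ω f X)
    (hY : IsHamiltonian Ω g Y) : IsHamiltonian Ω (dirDeriv X g) (lieBr X Y) := by
  rw [isHamiltonian_iff_chart] at hX hY ⊢
  intro x₀ y hy v
  have target_nhds := extChartAt_target_mem_nhds' (I := 𝓡 N) hy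
  have chart_eq : dirDeriv X g ∘ (extChartAt (𝓡 N) x₀).symm =ᶠ[nhds y] fun y' =>
      fderiv ℝ (g ∘ (extChartAt (𝓡 N) x₀).symm) y' (chartField X x₀ y') :=
    Filter.eventually_of_mem target_nhds fun y' => dirDeriv_comp_extChartAt_symm X g
  have two_le : minSmoothness ℝ 2 ≤ ∞ := by simpa using ENat.LEInfty.out
  rw [chart_eq.fderiv_eq, chartField_lieBr X Y hy]
  exact fderiv_apply_eq_apply_lieBracket
    (((hsmooth x₀).contDiffAt target_nhds).differentiableAt (by simp)) (hclosed x₀ y hy)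
    ((contDiffAt_chartField X hy).differentiableAt (by simp))
    ((contDiffAt_chartField Y hy).differentiableAt (by simp))
    ((contDiffAt_comp_extChartAt_symm f hy).of_le two_le)
    ((contDiffAt_comp_extChartAt_symm g hy).of_le two_le)
    (Filter.eventually_of_mem target_nhds (hX x₀)) (Filter.eventually_of_mem target_nhds (hY x₀)) v

end Manifold

section Polysymplectic

variable {N n : ℕ} {P : Type*} [TopologicalSpace P] [ChartedSpace (EuclideanSpace ℝ (Fin N)) P]

/-- The space of smooth closed 2-forms. -/
def closedForms (N : ℕ) (P : Type*) [TopologicalSpace P]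
    [ChartedSpace (EuclideanSpace ℝ (Fin N)) P] : Submodule ℝ (TwoForm N P) where
  carrier := {Ω | Ω.IsSmooth ∧ Ω.IsClosed}
  zero_mem' := ⟨fun _ => contDiffOn_const (c := 0), fun x₀ y _ => by
    have chartForm_zero : chartForm (0 : TwoForm N P) x₀ = (0 : ℝ) • 0 := by
      rw [zero_smul]
      rfl
    rw [chartForm_zero, extDeriv_smul, zero_smul]⟩
  add_mem' := by
    rintro Ω Ω' ⟨hsmooth, hclosed⟩ ⟨hsmooth', hclosed'⟩
    refine ⟨fun x₀ => (hsmooth x₀).add (hsmooth' x₀), fun x₀ y hy => ?_⟩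
    have target_nhds := extChartAt_target_mem_nhds' (I := 𝓡 N) hy
    refine (extDeriv_add (((hsmooth x₀).contDiffAt target_nhds).differentiableAt (by simp))
      (((hsmooth' x₀).contDiffAt target_nhds).differentiableAt (by simp))).trans ?_
    rw [hclosed x₀ y hy, hclosed' x₀ y hy, add_zero]
  smul_mem' := by
    rintro c Ω ⟨hsmooth, hclosed⟩
    refine ⟨fun x₀ => (hsmooth x₀).const_smul c, fun x₀ y hy => ?_⟩
    refine (extDeriv_smul c (chartForm Ω x₀)).trans ?_
    rw [hclosed x₀ y hy, smul_zero]

/-- The 2-form `t_α ω^α`. -/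
def Structure.combination (Ω : Structure N n P) (t : Fin n → ℝ) : TwoForm N P :=
  ∑ α, t α • Ω.form α

lemma Structure.combination_mem_closedForms (Ω : Structure N n P) (t : Fin n → ℝ) :
    Ω.combination t ∈ closedForms N P :=
  Submodule.sum_mem _ fun α _ => Submodule.smul_mem _ _ ⟨Ω.smooth α, Ω.closed α⟩

lemma Structure.polyEval_form (Ω : Structure N n P) (t : Fin n → ℝ) :
    polyEval t (fun J : Fin 1 → Fin n => Ω.form (J 0)) = Ω.combination t := by
  rw [polyEval_apply]
  exact Fintype.sum_equiv (Equiv.funUnique (Fin 1) (Fin n)) _ _ fun J => by simp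

variable [IsManifold (𝓡 N) ∞ P] {Ω : Structure N n P} {k l : ℕ}

lemma polyEval_symContract (Ω : Structure N n P) (X : (Fin k → Fin n) → VField N P)
    (t : Fin n → ℝ) (x : P) (v : TangentSpace (𝓡 N) x) :
    polyEval t (fun J => symContract Ω X J x v) = Ω.combination t x ![polyEval t X x, v] := by
  rw [← Ω.polyEval_form]
  exact (polyEval_symmetrize t _).trans (polyEval_append (contractₗ x v) t X fun J => Ω.form (J 0))

lemma isHamiltonian_polyEval_iff {f : (Fin (k + 1) → Fin n) → C^∞⟮𝓡 N, P; ℝ⟯}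
    (hf : IsSymmetric f) (X : (Fin k → Fin n) → VField N P) :
    (∀ t, IsHamiltonian (Ω.combination t) (polyEval t f) (polyEval t X)) ↔
      ∀ J x v, differential (f J) x v = symContract Ω X J x v := by
  have differential_polyEval (t : Fin n → ℝ) (x : P) (v : TangentSpace (𝓡 N) x) :
      differential (polyEval t f) x v = polyEval t fun J => differential (f J) x v :=
    map_polyEval (differentialₗ x v) t f
  simp only [IsHamiltonian, differential_polyEval, ← polyEval_symContract]
  refine ⟨fun h J x v => ?_, fun h t x v => by simp only [h]⟩
  have components_eq : (fun J => differential (f J) x v) = fun J => symContract Ω X J x v :=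
    (hf.comp (differential · x v)).ext_polyEval (isSymmetric_symmetrize _) fun t => h t x v
  exact congrFun components_eq J

lemma mem_kernelEq_iff {Y : (Fin k → Fin n) → VField N P} :
    Y ∈ kernelEq Ω k ↔ ∀ t, IsHamiltonian (Ω.combination t) 0 (polyEval t Y) := by
  have key := isHamiltonian_polyEval_iff (Ω := Ω) (f := 0) (fun _ _ => rfl) Y
  simp only [map_zero] at key
  rw [key]
  have differential_zero (x : P) (v : TangentSpace (𝓡 N) x) : differential 0 x v = 0 :=
    map_zero (differentialₗ x v)
  simp only [Pi.zero_apply, differential_zero, eq_comm (a := (0 : ℝ))]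
  rfl

lemma structureEq_smul_iff {f : (Fin (k + 1) → Fin n) → C^∞⟮𝓡 N, P; ℝ⟯} (hf : IsSymmetric f)
    {X : (Fin k → Fin n) → VField N P} :
    StructureEq Ω (-((k + 1)! : ℝ) • f) X ↔
      ∀ t, IsHamiltonian (Ω.combination t) (polyEval t f) (polyEval t X) := by
  have factor_ne_zero : -((k + 1)! : ℝ) ≠ 0 := neg_ne_zero.2 (by positivity)
  simp only [isHamiltonian_polyEval_iff hf, StructureEq, Pi.smul_apply, differential_smul,
    mul_right_inj' factor_ne_zero]

lemma mem_HVF_iff {X : (Fin k → Fin n) → VField N P} :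
    X ∈ HVF Ω k ↔ IsSymmetric X ∧ ∃ f : (Fin (k + 1) → Fin n) → C^∞⟮𝓡 N, P; ℝ⟯,
      ∀ t, IsHamiltonian (Ω.combination t) (polyEval t f) (polyEval t X) := by
  refine and_congr_right fun _ => ⟨?_, ?_⟩
  · rintro ⟨f, hf, hfX⟩
    have factor_ne_zero : -((k + 1)! : ℝ) ≠ 0 := neg_ne_zero.2 (by positivity)
    refine ⟨(-((k + 1)! : ℝ))⁻¹ • f, (structureEq_smul_iff (hf.smul _)).1 ?_⟩
    rwa [smul_inv_smul₀ factor_ne_zero]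
  · rintro ⟨f, hfX⟩
    have hsymm := isSymmetric_symmetrize f
    refine ⟨-((k + 1)! : ℝ) • symmetrize f, hsymm.smul _, (structureEq_smul_iff hsymm).2 ?_⟩
    simpa only [polyEval_symmetrize] using hfX

lemma polyEval_symBracket (t : Fin n → ℝ) (X : (Fin k → Fin n) → VField N P)
    (Y : (Fin l → Fin n) → VField N P) :
    polyEval t (symBracket X Y) = lieBr (polyEval t X) (polyEval t Y) :=
  (polyEval_symmetrize t _).trans (polyEval_append lieBrₗ t X Y)

lemma symBracket_mem_HVF {X : (Fin k → Fin n) → VField N P} {Y : (Fin l → Fin n) → VField N P}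
    (hX : X ∈ HVF Ω k) (hY : Y ∈ HVF Ω l) : symBracket X Y ∈ HVF Ω (k + l) := by
  obtain ⟨-, f, hfX⟩ := mem_HVF_iff.1 hX
  obtain ⟨-, g, hgY⟩ := mem_HVF_iff.1 hY
  refine mem_HVF_iff.2 ⟨isSymmetric_symmetrize _, fun K : Fin (k + (l + 1)) → Fin n =>
    dirDerivₗ (X (K ∘ Fin.castAdd (l + 1))) (g (K ∘ Fin.natAdd k)), fun t => ?_⟩
  obtain ⟨hsmooth, hclosed⟩ := Ω.combination_mem_closedForms t
  have bracket := (hfX t).dirDeriv_lieBr hsmooth hclosed (hgY t)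
  rw [← polyEval_symBracket] at bracket
  convert bracket using 1
  exact polyEval_append dirDerivₗ t X g

lemma symBracket_mem_kernelEq_right {X : (Fin k → Fin n) → VField N P}
    {Y : (Fin l → Fin n) → VField N P} (hX : X ∈ HVF Ω k) (hY : Y ∈ kernelEq Ω l) :
    symBracket X Y ∈ kernelEq Ω (k + l) := by
  obtain ⟨-, f, hfX⟩ := mem_HVF_iff.1 hX
  refine mem_kernelEq_iff.2 fun t => ?_
  obtain ⟨hsmooth, hclosed⟩ := Ω.combination_mem_closedForms t
  rw [polyEval_symBracket, ← map_zero (dirDerivₗ (polyEval t X))]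
  exact (hfX t).dirDeriv_lieBr hsmooth hclosed (mem_kernelEq_iff.1 hY t)

lemma symBracket_mem_kernelEq_left {X : (Fin k → Fin n) → VField N P}
    {Y : (Fin l → Fin n) → VField N P} (hX : X ∈ kernelEq Ω k) (hY : Y ∈ HVF Ω l) :
    symBracket X Y ∈ kernelEq Ω (k + l) := by
  refine mem_kernelEq_iff.2 fun t => ?_
  have swapped := (mem_kernelEq_iff.1 (symBracket_mem_kernelEq_right hY hX) t).neg
  rwa [neg_zero, polyEval_symBracket, ← lieBr_swap, ← polyEval_symBracket] at swapped

end Polysymplectic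

section GradedBilinear

variable {R ι : Type*} [CommSemiring R] [DecidableEq ι] [Add ι] {M : ι → Type*}
  [∀ i, AddCommMonoid (M i)] [∀ i, Module R (M i)]

/-- The bilinear map on a direct sum with the given homogeneous parts `M i × M j → M (i + j)`. -/
def gradedBilinear (b : ∀ i j, M i →ₗ[R] M j →ₗ[R] M (i + j)) :
    (⨁ i, M i) →ₗ[R] (⨁ i, M i) →ₗ[R] ⨁ i, M i :=
  DirectSum.toModule R ι _ fun i => LinearMap.flip <| DirectSum.toModule R ι _ fun j =>
    LinearMap.flip <| (b i j).compr₂ (DirectSum.lof R ι M (i + j))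

lemma gradedBilinear_lof (b : ∀ i j, M i →ₗ[R] M j →ₗ[R] M (i + j)) {i j : ι} (x : M i)
    (y : M j) :
    gradedBilinear b (DirectSum.lof R ι M i x) (DirectSum.lof R ι M j y) =
      DirectSum.lof R ι M (i + j) (b i j x y) := by
  simp only [gradedBilinear, DirectSum.toModule_lof, LinearMap.flip_apply, LinearMap.compr₂_apply]

end GradedBilinear

section Jacobiator

variable {R L : Type*} [CommSemiring R] [AddCommMonoid L] [Module R L]

/-- The left-hand side of the Jacobi identity, as a trilinear map: it vanishes as soon as it
vanishes on a generating set. -/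
def jacobiator (B : L →ₗ[R] L →ₗ[R] L) : L →ₗ[R] L →ₗ[R] L →ₗ[R] L :=
  LinearMap.mk₂ R (fun x y => B x ∘ₗ B y + B y ∘ₗ B.flip x + B.flip (B x y))
    (fun x x' y => by
      ext z
      simp only [map_add, LinearMap.add_apply, LinearMap.comp_apply, LinearMap.flip_apply]
      abel)
    (fun c x y => by ext z; simp)
    (fun x y y' => by
      ext z
      simp only [map_add, LinearMap.add_apply, LinearMap.comp_apply, LinearMap.flip_apply]
      abel)
    (fun c x y => by ext z; simp)

lemma jacobiator_apply (B : L →ₗ[R] L →ₗ[R] L) (x y z : L) :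
    jacobiator B x y z = B x (B y z) + B y (B z x) + B z (B x y) :=
  rfl

end Jacobiator

section Bracket

variable {N n : ℕ} {P : Type*} [TopologicalSpace P] [ChartedSpace (EuclideanSpace ℝ (Fin N)) P]
  [IsManifold (𝓡 N) ∞ P] {k l : ℕ}

lemma symBracket_add_left (X X' : (Fin k → Fin n) → VField N P)
    (Y : (Fin l → Fin n) → VField N P) :
    symBracket (X + X') Y = symBracket X Y + symBracket X' Y := by
  funext J
  simp only [symBracket, Pi.add_apply, lieBr_add_left]
  exact symmetrize_add _ _ J

lemma symBracket_smul_left (c : ℝ) (X : (Fin k → Fin n) → VField N P)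
    (Y : (Fin l → Fin n) → VField N P) : symBracket (c • X) Y = c • symBracket X Y := by
  funext J
  simp only [symBracket, Pi.smul_apply, lieBr_smul_left]
  exact symmetrize_smul c _ J

lemma symBracket_add_right (X : (Fin k → Fin n) → VField N P)
    (Y Y' : (Fin l → Fin n) → VField N P) :
    symBracket X (Y + Y') = symBracket X Y + symBracket X Y' := by
  funext J
  refine Eq.trans ?_ (symmetrize_add _ _ J)
  exact congrArg (symmetrize · J) (funext fun _ => map_add (lieBrₗ _) _ _)

lemma symBracket_smul_right (c : ℝ) (X : (Fin k → Fin n) → VField N P)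
    (Y : (Fin l → Fin n) → VField N P) : symBracket X (c • Y) = c • symBracket X Y := by
  funext J
  refine Eq.trans ?_ (symmetrize_smul c _ J)
  exact congrArg (symmetrize · J) (funext fun _ => map_smul (lieBrₗ _) c _)

variable (Ω : Structure N n P)

/-- `symBracket` as a bilinear map on Hamiltonian vector fields. -/
def hvfBracket (k l : ℕ) : HVF Ω k →ₗ[ℝ] HVF Ω l →ₗ[ℝ] HVF Ω (k + l) :=
  LinearMap.mk₂ ℝ (fun X Y => ⟨symBracket X.1 Y.1, symBracket_mem_HVF X.2 Y.2⟩)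
    (fun X X' Y => Subtype.ext (symBracket_add_left X.1 X'.1 Y.1))
    (fun c X Y => Subtype.ext (symBracket_smul_left c X.1 Y.1))
    (fun X Y Y' => Subtype.ext (symBracket_add_right X.1 Y.1 Y'.1))
    (fun c X Y => Subtype.ext (symBracket_smul_right c X.1 Y.1))

/-- The bracket `SHV^{k+1} × SHV^{l+1} → SHV^{k+l+1}` of equivalence classes. -/
def rankBracket (k l : ℕ) : SHVrank Ω k →ₗ[ℝ] SHVrank Ω l →ₗ[ℝ] SHVrank Ω (k + l) :=
  LinearMap.liftQ₂ _ _ ((hvfBracket Ω k l).compr₂ (Submodule.mkQ _))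
    (fun _ hX => LinearMap.ext fun Y => (Submodule.Quotient.mk_eq_zero _).2
      (symBracket_mem_kernelEq_left hX Y.2))
    (fun _ hY => LinearMap.ext fun X => (Submodule.Quotient.mk_eq_zero _).2
      (symBracket_mem_kernelEq_right X.2 hY))

/-- The bracket on `SHV`. -/
def shvBracket : SHV Ω →ₗ[ℝ] SHV Ω →ₗ[ℝ] SHV Ω :=
  gradedBilinear (rankBracket Ω)

variable {Ω}

lemma shvBracket_lof_cls (X : HVF Ω k) (Y : HVF Ω l) :
    shvBracket Ω (DirectSum.lof ℝ ℕ (SHVrank Ω) k (cls Ω X))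
        (DirectSum.lof ℝ ℕ (SHVrank Ω) l (cls Ω Y)) =
      DirectSum.lof ℝ ℕ (SHVrank Ω) (k + l) (cls Ω (hvfBracket Ω k l X Y)) :=
  gradedBilinear_lof (rankBracket Ω) (cls Ω X) (cls Ω Y)

lemma polyEval_hvfBracket (X : HVF Ω k) (Y : HVF Ω l) (t : Fin n → ℝ) :
    polyEval t (hvfBracket Ω k l X Y).1 = lieBr (polyEval t X.1) (polyEval t Y.1) :=
  polyEval_symBracket t X.1 Y.1

lemma shv_linearMap_ext {L : Type*} [AddCommMonoid L] [Module ℝ L] {F G : SHV Ω →ₗ[ℝ] L}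
    (h : ∀ (k : ℕ) (X : HVF Ω k), F (DirectSum.lof ℝ ℕ (SHVrank Ω) k (cls Ω X)) =
      G (DirectSum.lof ℝ ℕ (SHVrank Ω) k (cls Ω X))) : F = G := by
  refine DirectSum.linearMap_ext ℝ fun k => LinearMap.ext fun a => ?_
  obtain ⟨X, rfl⟩ := Submodule.Quotient.mk_surjective _ a
  exact h k X

lemma shv_bilinearMap_ext {L : Type*} [AddCommMonoid L] [Module ℝ L]
    {F G : SHV Ω →ₗ[ℝ] SHV Ω →ₗ[ℝ] L}
    (h : ∀ (k l : ℕ) (X : HVF Ω k) (Y : HVF Ω l),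
      F (DirectSum.lof ℝ ℕ (SHVrank Ω) k (cls Ω X))
          (DirectSum.lof ℝ ℕ (SHVrank Ω) l (cls Ω Y)) =
        G (DirectSum.lof ℝ ℕ (SHVrank Ω) k (cls Ω X))
          (DirectSum.lof ℝ ℕ (SHVrank Ω) l (cls Ω Y))) : F = G :=
  shv_linearMap_ext fun k X => shv_linearMap_ext fun l Y => h k l X Y

-- The degrees `k + l` and `l + k` of two brackets agree only propositionally, so a vanishing sum
-- in `SHV` of homogeneous elements is checked through their polynomials.
lemma lof_cls_add_eq_zero (hl : l = k) (X : HVF Ω k) (Y : HVF Ω l)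
    (h : ∀ t : Fin n → ℝ, polyEval t X.1 + polyEval t Y.1 = 0) :
    DirectSum.lof ℝ ℕ (SHVrank Ω) k (cls Ω X) +
      DirectSum.lof ℝ ℕ (SHVrank Ω) l (cls Ω Y) = 0 := by
  subst hl
  have sum_eq_zero : X + Y = 0 := Subtype.ext <|
    (X + Y).2.1.ext_polyEval (HVF Ω l).zero_mem.1 fun t => by
      rw [Submodule.coe_add, map_add, h t, Submodule.coe_zero, map_zero]
  rw [← map_add, ← Submodule.Quotient.mk_add, sum_eq_zero, Submodule.Quotient.mk_zero, map_zero]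

lemma lof_cls_add_add_eq_zero {m : ℕ} (hl : l = k) (hm : m = k) (X : HVF Ω k) (Y : HVF Ω l)
    (Z : HVF Ω m) (h : ∀ t : Fin n → ℝ, polyEval t X.1 + polyEval t Y.1 + polyEval t Z.1 = 0) :
    DirectSum.lof ℝ ℕ (SHVrank Ω) k (cls Ω X) + DirectSum.lof ℝ ℕ (SHVrank Ω) l (cls Ω Y) +
      DirectSum.lof ℝ ℕ (SHVrank Ω) m (cls Ω Z) = 0 := by
  subst hl
  rw [← map_add, ← Submodule.Quotient.mk_add]
  refine lof_cls_add_eq_zero hm (X + Y) Z fun t => ?_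
  rw [← h t, Submodule.coe_add, map_add]

lemma shvBracket_add_flip (Ω : Structure N n P) : shvBracket Ω + (shvBracket Ω).flip = 0 := by
  refine shv_bilinearMap_ext fun k l X Y => ?_
  simp only [LinearMap.add_apply, LinearMap.flip_apply, LinearMap.zero_apply, shvBracket_lof_cls]
  refine lof_cls_add_eq_zero (add_comm l k) _ _ fun t => ?_
  rw [polyEval_hvfBracket, polyEval_hvfBracket, lieBr_swap, neg_add_cancel]

lemma jacobiator_shvBracket (Ω : Structure N n P) : jacobiator (shvBracket Ω) = 0 := by
  refine shv_bilinearMap_ext fun k l X Y => shv_linearMap_ext fun m Z => ?_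
  simp only [jacobiator_apply, shvBracket_lof_cls, LinearMap.zero_apply]
  refine lof_cls_add_add_eq_zero (by lia) (by lia) _ _ _ fun t => ?_
  simp only [polyEval_hvfBracket, lieBr_jacobi]

lemma isLieBracket_shvBracket (Ω : Structure N n P) : IsLieBracket (shvBracket Ω) where
  alternating x := by
    have double_eq_zero : shvBracket Ω x x + shvBracket Ω x x = 0 :=
      LinearMap.congr_fun₂ (shvBracket_add_flip Ω) x x
    rwa [← two_smul ℝ, smul_eq_zero_iff_right two_ne_zero] at double_eq_zero
  jacobi x y z := by
    rw [← jacobiator_apply, jacobiator_shvBracket]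
    rfl

end Bracket

end NSymplectic

end

open NSymplectic in
theorem mainTheorem8_general {N n : ℕ} {P : Type*} [TopologicalSpace P]
    [ChartedSpace (EuclideanSpace ℝ (Fin N)) P] [IsManifold (𝓡 N) ∞ P] (Ω : Structure N n P) :
    ∃ closure : ∀ (k l : ℕ) (X : HVF Ω k) (Y : HVF Ω l), symBracket X.1 Y.1 ∈ HVF Ω (k + l),
      (∀ (k l : ℕ) (X X' : HVF Ω k) (Y Y' : HVF Ω l), cls Ω X = cls Ω X' → cls Ω Y = cls Ω Y' →
        cls Ω ⟨symBracket X.1 Y.1, closure k l X Y⟩ =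
          cls Ω ⟨symBracket X'.1 Y'.1, closure k l X' Y'⟩) ∧
      ∃! B : SHV Ω →ₗ[ℝ] SHV Ω →ₗ[ℝ] SHV Ω,
        (∀ (k l : ℕ) (X : HVF Ω k) (Y : HVF Ω l),
          B (DirectSum.lof ℝ ℕ (SHVrank Ω) k (cls Ω X))
              (DirectSum.lof ℝ ℕ (SHVrank Ω) l (cls Ω Y)) =
            DirectSum.lof ℝ ℕ (SHVrank Ω) (k + l)
              (cls Ω ⟨symBracket X.1 Y.1, closure k l X Y⟩)) ∧
        IsLieBracket B := by
  refine ⟨fun k l X Y => symBracket_mem_HVF X.2 Y.2, fun k l X X' Y Y' hX hY => ?_,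
    shvBracket Ω, ⟨fun k l X Y => shvBracket_lof_cls X Y, isLieBracket_shvBracket Ω⟩,
    fun B hB => shv_bilinearMap_ext fun k l X Y => ?_⟩
  · exact congrArg₂ (fun a b => rankBracket Ω k l a b) hX hY
  · exact (hB.1 k l X Y).trans (shvBracket_lof_cls X Y).symm

theorem mainTheorem8 {N n : ℕ} (hn : 1 ≤ n) (hnN : n ≤ N)
    {P : Type*} [TopologicalSpace P] [ChartedSpace (EuclideanSpace ℝ (Fin N)) P]
    [IsManifold (𝓡 N) ∞ P] (Ω : NSymplectic.Structure N n P) :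
    -- the symmetrized Lie bracket of Hamiltonian representatives is Hamiltonian,
    ∃ closure : ∀ (k l : ℕ) (X : NSymplectic.HVF Ω k) (Y : NSymplectic.HVF Ω l),
        NSymplectic.symBracket X.1 Y.1 ∈ NSymplectic.HVF Ω (k + l),
      -- its class depends only on the classes of the two representatives,
      (∀ (k l : ℕ) (X X' : NSymplectic.HVF Ω k) (Y Y' : NSymplectic.HVF Ω l),
        NSymplectic.cls Ω X = NSymplectic.cls Ω X' →
        NSymplectic.cls Ω Y = NSymplectic.cls Ω Y' →
        NSymplectic.cls Ω ⟨NSymplectic.symBracket X.1 Y.1, closure k l X Y⟩ =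
          NSymplectic.cls Ω ⟨NSymplectic.symBracket X'.1 Y'.1, closure k l X' Y'⟩) ∧
      -- and its bilinear extension to the direct sum is a Lie bracket
      ∃! B : NSymplectic.SHV Ω →ₗ[ℝ] NSymplectic.SHV Ω →ₗ[ℝ] NSymplectic.SHV Ω,
        (∀ (k l : ℕ) (X : NSymplectic.HVF Ω k) (Y : NSymplectic.HVF Ω l),
          B (DirectSum.lof ℝ ℕ (NSymplectic.SHVrank Ω) k (NSymplectic.cls Ω X))
              (DirectSum.lof ℝ ℕ (NSymplectic.SHVrank Ω) l (NSymplectic.cls Ω Y)) =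
            DirectSum.lof ℝ ℕ (NSymplectic.SHVrank Ω) (k + l)
              (NSymplectic.cls Ω ⟨NSymplectic.symBracket X.1 Y.1, closure k l X Y⟩)) ∧
        NSymplectic.IsLieBracket B :=
  mainTheorem8_general Ω
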